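/- Let $X$ be a complex Fano manifold of dimension $n$. If $X$ is asymptotically F-semistable, then $X$ is K-semistable. Here the notions are as follows. A test configuration $(\mathcal X,\mathcal L)$ for $(X,-K_X)$ of exponent $k\ge 1$ is a scheme $\mathcal X$ with an algebraic $\mathbb C^\ast$-action, a $\mathbb C^\ast$-equivariant flat proper morphism $\pi\colon\mathcal X\to\mathbb C$ (with the standard action on $\mathbb C$), a $\mathbb C^\ast$-linearized $\pi$-very ample line bundle $\mathcal L$ on $\mathcal X$, and an isomorphism $(\mathcal X_1,\mathcal L_1)\cong(X,-kK_X)$ of the fibre over $1$. Let $N_{km}=\dim H^0(\mathcal X_0,m\mathcal L_0)$, and let $w_{km}$ be the total weight of the induced $\mathbb C^\ast$-action on $H^0(\mathcal X_0,m\mathcal L_0)$. For large $m$ these have expansions $$N_{km}=a_0(km)^n+a_1(km)^{n-1}+\cdots+a_n,\qquad w_{km}=b_0(km)^{n+1}+b_1(km)^n+\cdots+b_{n+1}$$ (with $a_1=0$ if $n=0$). Put $$DF(\mathcal X,\mathcal L)=2\,\frac{a_1b_0-a_0b_1}{a_0^2},\qquad Chow_k(\mathcal X,\mathcal L)=\frac{b_0}{a_0}-\frac{w_k}{kN_k},\qquad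 Fut_k(\mathcal X,\mathcal L)=kN_k\bigl(DF(\mathcal X,\mathcal L)+Chow_k(\mathcal X,\mathcal L)\bigr).$$ $X$ is asymptotically F-semistable if there is a $k_0>0$ such that for all $k\ge k_0$ one has $Fut_k(\mathcal X,\mathcal L)\ge0$ for every test configuration $(\mathcal X,\mathcal L)$ for $(X,-K_X)$ of exponent $k$. $X$ is K-semistable if $DF(\mathcal X,\mathcal L)\ge0$ for every test configuration $(\mathcal X,\mathcal L)$ for $(X,-K_X)$ of any exponent $k\ge1$. -/

import Mathlib

noncomputable section

namespace FStability

open CategoryTheory AlgebraicGeometry TopologicalSpace Filter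

/-! ### Restriction of functions, and evaluation of functions at scheme-valued points -/

/-- The complex point. -/
abbrev SpecC : Scheme.{0} := Spec (CommRingCat.of ℂ)

/-- Restriction of functions from an open subset to a smaller one. -/
def res {S : Scheme.{0}} {V U : S.Opens} (h : V ≤ U) : Γ(S, U) →+* Γ(S, V) :=
  (S.presheaf.map (homOfLE h).op).hom

/-- Restriction of invertible functions. -/
def resU {S : Scheme.{0}} {V U : S.Opens} (h : V ≤ U) : Γ(S, U)ˣ →* Γ(S, V)ˣ :=
  Units.map (res h).toMonoidHom

/-- The value `f(x)` of a function `f` on the open subset `U` of `S` at a `T`-valued point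
`x : T ⟶ S` lying in `U`, as a function on `T`. -/
def evalAt {S T : Scheme.{0}} (x : T ⟶ S) {U : S.Opens} (h : ⊤ ≤ x ⁻¹ᵁ U) :
    Γ(S, U) →+* Γ(T, ⊤) :=
  (x.appLE U ⊤ h).hom

/-- The value of an invertible function at a `T`-valued point. -/
def evalAtU {S T : Scheme.{0}} (x : T ⟶ S) {U : S.Opens} (h : ⊤ ≤ x ⁻¹ᵁ U) :
    Γ(S, U)ˣ →* Γ(T, ⊤)ˣ :=
  Units.map (evalAt x h).toMonoidHom

/-- Pull-back of invertible global functions along a morphism `f : T' ⟶ T`: the functoriality of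
the multiplicative group `𝔾ₘ(T) = Γ(T, 𝒪_T)ˣ`. -/
def pullU {T' T : Scheme.{0}} (f : T' ⟶ T) : Γ(T, ⊤)ˣ →* Γ(T', ⊤)ˣ :=
  Units.map f.appTop.hom.toMonoidHom

/-- For a complex scheme, the ring homomorphism embedding the constants into the functions on an
open subset. -/
def constants (S : Scheme.{0}) [S.Over SpecC] (U : S.Opens) : ℂ →+* Γ(S, U) :=
  (res (le_top : U ≤ ⊤)).comp
    ((S ↘ SpecC).appTop.hom.comp (Scheme.ΓSpecIso (CommRingCat.of ℂ)).inv.hom)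

instance algebraSections (S : Scheme.{0}) [S.Over SpecC] (U : S.Opens) : Algebra ℂ Γ(S, U) :=
  (constants S U).toAlgebra

theorem evalAt_constants {S T : Scheme.{0}} [S.Over SpecC] (x : T ⟶ S) {U : S.Opens}
    (h : ⊤ ≤ x ⁻¹ᵁ U) (c : ℂ) : evalAt x h (constants S U c) =
      (x ≫ S ↘ SpecC).appTop ((Scheme.ΓSpecIso (CommRingCat.of ℂ)).inv c) := by
  have h1 := Scheme.Hom.map_appLE x h (homOfLE (le_top : U ≤ ⊤)).op
  have h2 : x.appLE ⊤ ⊤ le_top = x.appTop := x.appLE_eq_app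
  have := congr($(h1) ((S ↘ SpecC).appTop ((Scheme.ΓSpecIso (CommRingCat.of ℂ)).inv c)))
  rw [h2] at this
  rw [Scheme.Hom.comp_appTop]
  exact this

/-! ### Line bundles -/

/-- A line bundle on a scheme `S`, given by an open cover `U i`, with local frames `e i` on `U i`,
and transition functions `g i j`, where `e j = g i j • e i` on `U i ⊓ U j`. -/
structure LineBundle (S : Scheme.{0}) where
  /-- index set of the cover -/
  ι : Type
  /-- the trivialising open cover -/
  U : ι → S.Opens
  cover : ⨆ i, U i = ⊤
  /-- the transition functions -/
  g : ∀ i j, Γ(S, U i ⊓ U j)ˣ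
  cocycle : ∀ i j k,
    resU (inf_le_left : U i ⊓ U j ⊓ U k ≤ U i ⊓ U j) (g i j) *
      resU (le_inf (inf_le_left.trans inf_le_right) inf_le_right) (g j k) =
    resU (le_inf (inf_le_left.trans inf_le_left) inf_le_right) (g i k)

namespace LineBundle

variable {S : Scheme.{0}}

/-- The tensor power `L^{⊗ m}` for an integer `m`; negative powers are powers of the dual. Its local
frames are the powers of those of `L`. -/
@[reducible] def pow (L : LineBundle S) (m : ℤ) : LineBundle S where
  ι := L.ι
  U := L.U
  cover := L.cover
  g i j := L.g i j ^ m
  cocycle i j k := by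
    rw [map_zpow, map_zpow, map_zpow, ← mul_zpow, L.cocycle]

/-- The pull-back of a line bundle along a morphism. Its local frames are the pull-backs of those
of `L`. -/
@[reducible] def pullback {S' : Scheme.{0}} (f : S' ⟶ S) (L : LineBundle S) : LineBundle S' where
  ι := L.ι
  U i := f ⁻¹ᵁ L.U i
  cover := by rw [← Scheme.Hom.preimage_iSup, L.cover]; rfl
  g i j := Units.map (f.app (L.U i ⊓ L.U j)).hom.toMonoidHom (L.g i j)
  cocycle i j k := by
    have key : ∀ {A B : S.Opens} (h : A ≤ B) (h' : f ⁻¹ᵁ A ≤ f ⁻¹ᵁ B) (u : Γ(S, B)ˣ),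
        resU h' (Units.map (f.app B).hom.toMonoidHom u) =
          Units.map (f.app A).hom.toMonoidHom (resU h u) := by
      intro A B h h' u
      ext
      exact (congr($(f.naturality (homOfLE h).op) (u : Γ(S, B)))).symm
    have := congrArg (Units.map (f.app (L.U i ⊓ L.U j ⊓ L.U k)).hom.toMonoidHom) (L.cocycle i j k)
    rw [map_mul, ← key, ← key, ← key] at this
    exact this

/-- An isomorphism of line bundles on `S`, given in the local frames `e i` and `e' a` of `L` and `M`
by invertible functions: `e i ↦ φ i a • e' a` on `L.U i ⊓ M.U a`. -/
structure Iso (L M : LineBundle S) where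
  /-- the local expressions of the isomorphism -/
  φ : ∀ i a, Γ(S, L.U i ⊓ M.U a)ˣ
  source : ∀ i j a,
    resU (le_inf (inf_le_left.trans inf_le_right) inf_le_right :
      L.U i ⊓ L.U j ⊓ M.U a ≤ L.U j ⊓ M.U a) (φ j a) =
    resU inf_le_left (L.g i j) * resU (le_inf (inf_le_left.trans inf_le_left) inf_le_right) (φ i a)
  target : ∀ i a b,
    resU (le_inf inf_le_left (inf_le_right.trans inf_le_left) :
      L.U i ⊓ (M.U a ⊓ M.U b) ≤ L.U i ⊓ M.U a) (φ i a) =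
    resU inf_le_right (M.g a b) *
      resU (le_inf inf_le_left (inf_le_right.trans inf_le_right)) (φ i b)

/-- The sections of `L` over an open subset `W`: families of functions `f i` on `W ⊓ U i` for which
the local sections `f i • e i` agree on overlaps. -/
def Sections (L : LineBundle S) (W : S.Opens) : Type :=
  {f : ∀ i, Γ(S, W ⊓ L.U i) // ∀ i j,
    res (inf_le_inf_left W inf_le_left : W ⊓ (L.U i ⊓ L.U j) ≤ W ⊓ L.U i) (f i) =
      res inf_le_right (L.g i j : Γ(S, L.U i ⊓ L.U j)) *
        res (inf_le_inf_left W inf_le_right) (f j)}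

namespace Sections

variable {L : LineBundle S} {W : S.Opens}

@[ext] theorem ext {s t : L.Sections W} (h : ∀ i, s.1 i = t.1 i) : s = t :=
  Subtype.ext (funext h)

/-- The additive group of sections, as a subgroup of a product. -/
def asSubgroup (L : LineBundle S) (W : S.Opens) : AddSubgroup (∀ i, Γ(S, W ⊓ L.U i)) where
  carrier := {f | ∀ i j,
    res (inf_le_inf_left W inf_le_left : W ⊓ (L.U i ⊓ L.U j) ≤ W ⊓ L.U i) (f i) =
      res inf_le_right (L.g i j : Γ(S, L.U i ⊓ L.U j)) *
        res (inf_le_inf_left W inf_le_right) (f j)}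
  add_mem' {a b} ha hb i j := by
    simp only [Pi.add_apply, map_add, mul_add]
    rw [ha i j, hb i j]
  zero_mem' i j := by simp
  neg_mem' {a} ha i j := by
    simp only [Pi.neg_apply, map_neg, mul_neg]
    rw [ha i j]

instance : AddCommGroup (L.Sections W) :=
  inferInstanceAs (AddCommGroup (asSubgroup L W))

theorem res_res {A B C : S.Opens} (h : A ≤ B) (h' : B ≤ C) (c : Γ(S, C)) :
    res h (res h' c) = res (h.trans h') c := by
  have := S.presheaf.map_comp (homOfLE h').op (homOfLE h).op
  exact (congr($(this) c)).symm

/-- Multiplication of sections by functions. -/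
instance : SMul Γ(S, W) (L.Sections W) where
  smul c s := ⟨fun i => res inf_le_left c * s.1 i, fun i j => by
    rw [map_mul, map_mul, s.2 i j, res_res, res_res]; ring⟩

theorem smul_val (c : Γ(S, W)) (s : L.Sections W) (i : L.ι) :
    (c • s).1 i = res inf_le_left c * s.1 i := rfl

theorem add_val (s t : L.Sections W) (i : L.ι) : (s + t).1 i = s.1 i + t.1 i := rfl

theorem zero_val (i : L.ι) : (0 : L.Sections W).1 i = 0 := rfl

instance : Module Γ(S, W) (L.Sections W) where
  one_smul s := by ext i; simp [smul_val]
  mul_smul c d s := by ext i; simp [smul_val, mul_assoc]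
  smul_zero c := by ext i; simp [smul_val, zero_val]
  zero_smul s := by ext i; simp [smul_val, zero_val]
  smul_add c s t := by ext i; simp [smul_val, add_val, mul_add]
  add_smul c d s := by ext i; simp [smul_val, add_val, add_mul]

/-- On a complex scheme, the sections of a line bundle form a complex vector space. -/
instance [S.Over SpecC] : Module ℂ (L.Sections W) := Module.compHom _ (constants S W)

/-- Restriction of sections to a smaller open subset. -/
def restrict {V : S.Opens} (h : V ≤ W) (s : L.Sections W) : L.Sections V :=
  ⟨fun i => res (inf_le_inf_right _ h) (s.1 i), fun i j => by
    have := congrArg (res (inf_le_inf_right (L.U i ⊓ L.U j) h)) (s.2 i j)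
    rw [map_mul] at this
    simp only [res_res] at this ⊢
    exact this⟩

/-- The value of a global section `s` at a `T`-valued point `x` lying in `U i`, with respect to the
frame `e i`: one has `s(x) = s.coord x i • e i (x)`. -/
def coord (s : L.Sections ⊤) {T : Scheme.{0}} (x : T ⟶ S) (i : L.ι) (h : ⊤ ≤ x ⁻¹ᵁ L.U i) :
    Γ(T, ⊤) :=
  evalAt x (U := ⊤ ⊓ L.U i) (le_inf le_top h) (s.1 i)

theorem coord_add (s t : L.Sections ⊤) {T : Scheme.{0}} (x : T ⟶ S) (i : L.ι)
    (h : ⊤ ≤ x ⁻¹ᵁ L.U i) : (s + t).coord x i h = s.coord x i h + t.coord x i h :=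
  map_add (evalAt x (U := ⊤ ⊓ L.U i) (le_inf le_top h)) _ _

theorem coord_zero {T : Scheme.{0}} (x : T ⟶ S) (i : L.ι)
    (h : ⊤ ≤ x ⁻¹ᵁ L.U i) : (0 : L.Sections ⊤).coord x i h = 0 :=
  map_zero (evalAt x (U := ⊤ ⊓ L.U i) (le_inf le_top h))

theorem coord_smul [S.Over SpecC] (c : ℂ) (s : L.Sections ⊤) {T : Scheme.{0}} (x : T ⟶ S)
    (i : L.ι) (h : ⊤ ≤ x ⁻¹ᵁ L.U i) : (c • s).coord x i h =
      (x ≫ S ↘ SpecC).appTop ((Scheme.ΓSpecIso (CommRingCat.of ℂ)).inv c) * s.coord x i h := by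
  rw [← evalAt_constants x (U := ⊤ ⊓ L.U i) (le_inf le_top h) c]
  unfold coord
  rw [← map_mul]
  congr 1
  change res inf_le_left (constants S ⊤ c) * s.1 i = _
  congr 1
  exact res_res _ _ _

/-- The open subset on which a global section does not vanish. -/
def nonvanishing (s : L.Sections ⊤) : S.Opens := ⨆ i, S.basicOpen (s.1 i)

end Sections

/-- Very ampleness of `L` relative to an affine base `Spec R`: there are finitely many global
sections `s 0, …, s N` of `L` without common zeros, for which the induced morphism
`(s 0 : … : s N)` from `S` to projective `N`-space over `R` is a closed immersion. The latter is
expressed in the standard charts: over the chart where the `i`-th homogeneous coordinate does not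
vanish, which is an affine `N`-space over `R`, the morphism is given by the quotients `s j / s i`
(for `j ≠ i`) on the non-vanishing locus of `s i`. (For a proper `S` over `Spec R`, every immersion
into a projective space is closed.) -/
def IsVeryAmple {R : CommRingCat.{0}} (f : S ⟶ Spec R) (L : LineBundle S) : Prop :=
  ∃ (N : ℕ) (s : Fin (N + 1) → L.Sections ⊤),
    (⨆ i, (s i).nonvanishing = ⊤) ∧
    ∀ i, ∃ q : {j : Fin (N + 1) // j ≠ i} → Γ(S, (s i).nonvanishing),
      (∀ j, (s j.1).restrict (le_top : (s i).nonvanishing ≤ ⊤) = q j • (s i).restrict le_top) ∧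
      IsClosedImmersion (AffineSpace.homOfVector ((s i).nonvanishing.ι ≫ f)
        (fun j => (s i).nonvanishing.topIso.inv (q j)))

/-- Ampleness of a line bundle relative to an affine base: some positive power is very ample. -/
def IsAmple {R : CommRingCat.{0}} (f : S ⟶ Spec R) (L : LineBundle S) : Prop :=
  ∃ r : ℕ, 0 < r ∧ (L.pow r).IsVeryAmple f

/-- An isomorphism between the sheaf of sections of the line bundle `K` and the sheaf
`Ω^n` of differential forms of degree `n`: on each affine open subset `V` an isomorphism of the
`n`-th exterior power of the module of Kähler differentials of `Γ(S, V)` over `ℂ` with the sections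
of `K` over `V`, compatible with restriction (it suffices to say so on the generators
`da₁ ∧ ⋯ ∧ daₙ`). -/
structure CanonicalIso (n : ℕ) [S.Over SpecC] (K : LineBundle S) where
  /-- the isomorphism on affine open subsets -/
  θ : ∀ V : S.affineOpens,
    (⋀[Γ(S, V.1)]^n (Ω[Γ(S, V.1)⁄ℂ])) ≃ₗ[Γ(S, V.1)] K.Sections V.1
  natural : ∀ (V V' : S.affineOpens) (h : V'.1 ≤ V.1) (a : Fin n → Γ(S, V.1)),
    θ V' (exteriorPower.ιMulti Γ(S, V'.1) n
        (fun i => KaehlerDifferential.D ℂ Γ(S, V'.1) (res h (a i)))) =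
      (θ V (exteriorPower.ιMulti Γ(S, V.1) n
        (fun i => KaehlerDifferential.D ℂ Γ(S, V.1) (a i)))).restrict h

end LineBundle

/-! ### Actions of the multiplicative group -/

/-- An algebraic action of the multiplicative group `𝔾ₘ` (that is, of `ℂ^*`) on a complex scheme
`S`, through functors of points: the groups `𝔾ₘ(T) = Γ(T, 𝒪_T)ˣ` act on the sets `S(T)` of
`T`-valued points, naturally in the scheme `T`. -/
structure GmAction (S : Scheme.{0}) [S.Over SpecC] where
  /-- the point `u · x` -/
  act : ∀ {T : Scheme.{0}}, Γ(T, ⊤)ˣ → (T ⟶ S) → (T ⟶ S)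
  one_act : ∀ {T : Scheme.{0}} (x : T ⟶ S), act 1 x = x
  mul_act : ∀ {T : Scheme.{0}} (v u : Γ(T, ⊤)ˣ) (x : T ⟶ S), act (v * u) x = act v (act u x)
  natural : ∀ {T' T : Scheme.{0}} (f : T' ⟶ T) (u : Γ(T, ⊤)ˣ) (x : T ⟶ S),
    act (pullU f u) (f ≫ x) = f ≫ act u x
  act_over : ∀ {T : Scheme.{0}} (u : Γ(T, ⊤)ˣ) (x : T ⟶ S), act u x ≫ S ↘ SpecC = x ≫ S ↘ SpecC

/-- A linearization of a line bundle `L` with respect to an action of `𝔾ₘ` on `S`: a lift of the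
action to the total space of `L` which is linear on fibres. If `x` is a `T`-valued point lying in
`U i` such that `u · x` lies in `U a`, then the lift sends the frame `e i (x)` of the fibre of `L`
at `x` to `φ u x i a • e a (u · x)`. -/
structure Linearization {S : Scheme.{0}} [S.Over SpecC] (A : GmAction S) (L : LineBundle S) where
  /-- the local expressions of the lifted action -/
  φ : ∀ {T : Scheme.{0}} (u : Γ(T, ⊤)ˣ) (x : T ⟶ S) (i a : L.ι),
    ⊤ ≤ x ⁻¹ᵁ L.U i → ⊤ ≤ (A.act u x) ⁻¹ᵁ L.U a → Γ(T, ⊤)ˣ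
  natural : ∀ {T' T : Scheme.{0}} (f : T' ⟶ T) (u : Γ(T, ⊤)ˣ) (x : T ⟶ S) (i a : L.ι)
    (hi : ⊤ ≤ x ⁻¹ᵁ L.U i) (ha : ⊤ ≤ (A.act u x) ⁻¹ᵁ L.U a)
    (hi' : ⊤ ≤ (f ≫ x) ⁻¹ᵁ L.U i) (ha' : ⊤ ≤ (A.act (pullU f u) (f ≫ x)) ⁻¹ᵁ L.U a),
    φ (pullU f u) (f ≫ x) i a hi' ha' = pullU f (φ u x i a hi ha)
  source : ∀ {T : Scheme.{0}} (u : Γ(T, ⊤)ˣ) (x : T ⟶ S) (i j a : L.ι)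
    (hi : ⊤ ≤ x ⁻¹ᵁ L.U i) (hj : ⊤ ≤ x ⁻¹ᵁ L.U j) (ha : ⊤ ≤ (A.act u x) ⁻¹ᵁ L.U a),
    φ u x j a hj ha = evalAtU x (U := L.U i ⊓ L.U j) (le_inf hi hj) (L.g i j) * φ u x i a hi ha
  target : ∀ {T : Scheme.{0}} (u : Γ(T, ⊤)ˣ) (x : T ⟶ S) (i a b : L.ι)
    (hi : ⊤ ≤ x ⁻¹ᵁ L.U i) (ha : ⊤ ≤ (A.act u x) ⁻¹ᵁ L.U a) (hb : ⊤ ≤ (A.act u x) ⁻¹ᵁ L.U b),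
    φ u x i a hi ha =
      evalAtU (A.act u x) (U := L.U a ⊓ L.U b) (le_inf ha hb) (L.g a b) * φ u x i b hi hb
  mul_act : ∀ {T : Scheme.{0}} (v u : Γ(T, ⊤)ˣ) (x : T ⟶ S) (i a b : L.ι)
    (hi : ⊤ ≤ x ⁻¹ᵁ L.U i) (ha : ⊤ ≤ (A.act u x) ⁻¹ᵁ L.U a)
    (hb : ⊤ ≤ (A.act v (A.act u x)) ⁻¹ᵁ L.U b) (hb' : ⊤ ≤ (A.act (v * u) x) ⁻¹ᵁ L.U b),
    φ (v * u) x i b hi hb' = φ v (A.act u x) a b ha hb * φ u x i a hi ha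

/-! ### Test configurations -/

/-- The affine line over `ℂ`. -/
abbrev A1 : Scheme.{0} := Spec (CommRingCat.of (Polynomial ℂ))

/-- The structure morphism of the affine line. -/
def A1.toSpecC : A1 ⟶ SpecC := Spec.map (CommRingCat.ofHom Polynomial.C)

/-- The closed point `c` of the affine line. -/
def A1.pt (c : ℂ) : SpecC ⟶ A1 := Spec.map (CommRingCat.ofHom (Polynomial.evalRingHom c))

/-- The coordinate of a `T`-valued point of the affine line. -/
def A1.coord {T : Scheme.{0}} (y : T ⟶ A1) : Γ(T, ⊤) :=
  y.appTop ((Scheme.ΓSpecIso (CommRingCat.of (Polynomial ℂ))).inv (Polynomial.X : Polynomial ℂ))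

/-- A test configuration of exponent `k` for a complex scheme `X` polarized by a line
bundle `L`. -/
structure TestConfiguration (X : Scheme.{0}) [X.Over SpecC] (L : LineBundle X) (k : ℕ) where
  /-- the total space -/
  space : Scheme.{0}
  /-- the projection to the affine line -/
  π : space ⟶ A1
  flat : Flat π
  proper : IsProper π
  /-- the total space as a complex scheme -/
  [overC : space.Over SpecC]
  π_over : π ≫ A1.toSpecC = space ↘ SpecC
  /-- the action of `ℂ^*` on the total space -/
  action : GmAction space
  /-- equivariance of the projection: `π (u · x) = u * π (x)` -/
  equivariant : ∀ {T : Scheme.{0}} (u : Γ(T, ⊤)ˣ) (x : T ⟶ space),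
    A1.coord (action.act u x ≫ π) = u * A1.coord (x ≫ π)
  /-- the line bundle on the total space -/
  bundle : LineBundle space
  /-- its linearization -/
  lin : Linearization action bundle
  veryAmple : bundle.IsVeryAmple π
  /-- the identification of `X` with the fibre over `1` -/
  incl : X ⟶ space
  isFibre : IsPullback incl (X ↘ SpecC) π (A1.pt 1)
  /-- the identification of the line bundle on the fibre over `1` -/
  isoFibre : (bundle.pullback incl).Iso (L.pow k)

namespace TestConfiguration

variable {X : Scheme.{0}} [X.Over SpecC] {L : LineBundle X} {k : ℕ}

attribute [instance] TestConfiguration.overC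

/-- The central fibre, that is, the scheme-theoretic fibre over `0`. -/
def central (T : TestConfiguration X L k) : Scheme.{0} := Limits.pullback T.π (A1.pt 0)

/-- The inclusion of the central fibre. -/
def centralι (T : TestConfiguration X L k) : T.central ⟶ T.space := Limits.pullback.fst _ _

instance (T : TestConfiguration X L k) : T.central.Over SpecC := ⟨T.centralι ≫ T.space ↘ SpecC⟩

/-- The restriction of the `m`-th power of the line bundle to the central fibre. -/
@[reducible] def centralPow (T : TestConfiguration X L k) (m : ℕ) : LineBundle T.central :=
  (T.bundle.pow m).pullback T.centralι

/-- `N_{km}`, the dimension of the space of global sections of the `m`-th power of the line bundle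
on the central fibre. -/
def N (T : TestConfiguration X L k) (m : ℕ) : ℕ :=
  Module.finrank ℂ ((T.centralPow m).Sections ⊤)

/-- The subspace of weight `l` of the action of `ℂ^*` on the global sections of the `m`-th power of
the line bundle on the central fibre, where `u` acts on a section `s` by
`(u · s)(y) = u · s(u⁻¹ · y)`. A section has weight `l` if `u · s = u ^ l • s`, in other words if
`u · s(x) = u ^ l • s(u · x)` for every scheme-valued point `u` of `ℂ^*` and every scheme-valued
point `x` of the central fibre. Here `x'` denotes the point `u · x`. -/
def weightSpace (T : TestConfiguration X L k) (m : ℕ) (l : ℤ) :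
    Submodule ℂ ((T.centralPow m).Sections ⊤) where
  carrier := {s | ∀ {Z : Scheme.{0}} (u : Γ(Z, ⊤)ˣ) (x x' : Z ⟶ T.central)
    (_ : x' ≫ T.centralι = T.action.act u (x ≫ T.centralι)) (i a : T.bundle.ι)
    (hi : ⊤ ≤ x ⁻¹ᵁ (T.centralPow m).U i) (ha : ⊤ ≤ x' ⁻¹ᵁ (T.centralPow m).U a)
    (hi' : ⊤ ≤ (x ≫ T.centralι) ⁻¹ᵁ T.bundle.U i)
    (ha' : ⊤ ≤ (T.action.act u (x ≫ T.centralι)) ⁻¹ᵁ T.bundle.U a),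
    s.coord x i hi * ((T.lin.φ u (x ≫ T.centralι) i a hi' ha' ^ m : Γ(Z, ⊤)ˣ) : Γ(Z, ⊤)) =
      ((u ^ l : Γ(Z, ⊤)ˣ) : Γ(Z, ⊤)) * s.coord x' a ha}
  add_mem' {s t} hs ht := by
    intro Z u x x' hx i a hi ha hi' ha'
    have h1 := hs u x x' hx i a hi ha hi' ha'
    have h2 := ht u x x' hx i a hi ha hi' ha'
    rw [LineBundle.Sections.coord_add, LineBundle.Sections.coord_add, add_mul, mul_add, h1, h2]
  zero_mem' := by
    intro Z u x x' hx i a hi ha hi' ha'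
    rw [LineBundle.Sections.coord_zero, LineBundle.Sections.coord_zero, zero_mul, mul_zero]
  smul_mem' c s hs := by
    intro Z u x x' hx i a hi ha hi' ha'
    have h1 := hs u x x' hx i a hi ha hi' ha'
    have hover : x' ≫ T.central ↘ SpecC = x ≫ T.central ↘ SpecC := by
      change x' ≫ T.centralι ≫ T.space ↘ SpecC = x ≫ T.centralι ≫ T.space ↘ SpecC
      rw [← Category.assoc, hx, T.action.act_over, Category.assoc]
    rw [LineBundle.Sections.coord_smul, LineBundle.Sections.coord_smul, hover, mul_assoc, h1]
    ring

/-- `w_{km}`, the total weight of the action of `ℂ^*` on the global sections of the `m`-th power of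
the line bundle on the central fibre. -/
def w (T : TestConfiguration X L k) (m : ℕ) : ℤ :=
  ∑ᶠ l : ℤ, l * (Module.finrank ℂ (T.weightSpace m l) : ℤ)

/-- `P` is a polynomial of degree at most `d` with `f m = P (k * m)` for all large `m`. -/
def IsExpansion (k d : ℕ) (f : ℕ → ℝ) (P : Polynomial ℝ) : Prop :=
  P.natDegree ≤ d ∧ ∀ᶠ m : ℕ in atTop, f m = P.eval ((k : ℝ) * m)

open Classical in
/-- The polynomial in `k * m`, of degree at most `d`, which computes `f m` for all large `m`; it
is unique for `k > 0`, and it exists for the dimensions and total weights of every test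
configuration (the value `0` is assigned to other `f`). -/
def expansion (k d : ℕ) (f : ℕ → ℝ) : Polynomial ℝ :=
  if h : ∃ P, IsExpansion k d f P then h.choose else 0

/-- The coefficient `a_i` in `N_{km} = a_0 (km)^n + a_1 (km)^(n-1) + ⋯ + a_n` for large `m`. -/
def a (n : ℕ) (T : TestConfiguration X L k) (i : ℕ) : ℝ :=
  if i ≤ n then (expansion k n (fun m => (T.N m : ℝ))).coeff (n - i) else 0

/-- The coefficient `b_i` in `w_{km} = b_0 (km)^(n+1) + b_1 (km)^n + ⋯ + b_{n+1}` for
large `m`. -/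
def b (n : ℕ) (T : TestConfiguration X L k) (i : ℕ) : ℝ :=
  if i ≤ n + 1 then (expansion k (n + 1) (fun m => (T.w m : ℝ))).coeff (n + 1 - i) else 0

/-- The Chow weight. -/
def chow (n : ℕ) (T : TestConfiguration X L k) : ℝ :=
  T.b n 0 / T.a n 0 - T.w 1 / (k * T.N 1)

/-- The Donaldson-Futaki invariant. -/
def DF (n : ℕ) (T : TestConfiguration X L k) : ℝ :=
  2 * ((T.a n 1 * T.b n 0 - T.a n 0 * T.b n 1) / T.a n 0 ^ 2)

/-- The quantized Futaki invariant. -/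
def fut (n : ℕ) (T : TestConfiguration X L k) : ℝ :=
  k * T.N 1 * (T.DF n + T.chow n)

end TestConfiguration

/-! ### Fano manifolds and their stability -/

/-- A complex Fano manifold of dimension `n`: a smooth, proper, integral complex scheme `X` of
dimension `n` whose anti-canonical bundle is ample, together with its canonical bundle, given by
transition functions. -/
structure FanoManifold (n : ℕ) where
  /-- the underlying scheme -/
  X : Scheme.{0}
  /-- the structure morphism -/
  [overC : X.Over SpecC]
  integral : IsIntegral X
  smooth : SmoothOfRelativeDimension n (X ↘ SpecC)
  proper : IsProper (X ↘ SpecC)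
  /-- the canonical bundle -/
  K : LineBundle X
  /-- its identification with the sheaf of differential forms of degree `n` -/
  canonical : K.CanonicalIso n
  ample : (K.pow (-1)).IsAmple (X ↘ SpecC)

namespace FanoManifold

variable {n : ℕ}

attribute [instance] FanoManifold.overC

/-- The anti-canonical bundle. -/
def antiK (F : FanoManifold n) : LineBundle F.X := F.K.pow (-1)

/-- F-semistability at level `k`. -/
def FSemistableAt (F : FanoManifold n) (k : ℕ) : Prop :=
  ∀ T : TestConfiguration F.X F.antiK k, 0 ≤ T.fut n

/-- Asymptotic F-semistability. -/
def AsymptoticallyFSemistable (F : FanoManifold n) : Prop :=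
  ∃ k₀ : ℕ, 0 < k₀ ∧ ∀ k : ℕ, k₀ ≤ k → F.FSemistableAt k

/-- K-semistability; test configurations of all exponents `k ≥ 1` are considered. -/
def KSemistable (F : FanoManifold n) : Prop :=
  ∀ k : ℕ, 0 < k → ∀ T : TestConfiguration F.X F.antiK k, 0 ≤ T.DF n

end FanoManifold

end FStability

end

/-! Let `T` be a test configuration of exponent `k`. Replacing its line bundle by the `m`-th power
gives one of exponent `k * m` on the same space. Its `j`-th dimension and weight are those of `T` at
`m * j`; since the expansions are taken in the variable `km`, the polynomials are unchanged, and so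
are all `a_i`, `b_i` and DF (`a_pow`, `b_pow`). Its Chow weight `b_0/a_0 - w_{km}/(km N_{km})` tends
to 0 as `m` grows, because `w_{km}/(km N_{km})` tends to the ratio of the leading coefficients. For
large `m` semistability gives Fut ≥ 0; dividing by `km N_{km} > 0` gives DF + Chow ≥ 0, and the
limit is DF ≥ 0 (`DF_nonneg`).

The geometric input is that powers of a very ample bundle are very ample (`IsVeryAmple.pow`), the
Veronese embedding. In each chart a closed immersion is a statement about ring generators
(`isClosedImmersion_homOfVector_iff`), which can be checked on products of sections. -/

noncomputable section

namespace FStability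

open CategoryTheory AlgebraicGeometry TopologicalSpace Filter

/-! ### Closed immersions into affine space -/

/-- The functions on an open subset of `S` which come from an affine base `Spec R`. -/
def baseFunctions {S : Scheme.{0}} {R : CommRingCat.{0}} (f : S ⟶ Spec R) (U : S.Opens) :
    R →+* Γ(S, U) :=
  (res (le_top : U ≤ ⊤)).comp (f.appTop.hom.comp (Scheme.ΓSpecIso R).inv.hom)

theorem res_baseFunctions {S : Scheme.{0}} {R : CommRingCat.{0}} (f : S ⟶ Spec R) {V U : S.Opens}
    (h : V ≤ U) (r : R) : res h (baseFunctions f U r) = baseFunctions f V r :=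
  LineBundle.Sections.res_res h le_top _

/-- The functions on an affine space over `Spec R` are polynomials in the coordinates. -/
theorem closure_coord_eq_top {R : CommRingCat.{0}} (κ : Type) :
    Subring.closure (Set.range ((𝔸(κ; Spec R) ↘ Spec R).appTop.hom.comp
      (Scheme.ΓSpecIso R).inv.hom) ∪ Set.range (AffineSpace.coord (n := κ) (Spec R))) = ⊤ := by
  rw [eq_top_iff]
  rintro y -
  obtain ⟨z, rfl⟩ : ∃ z, (AffineSpace.SpecIso κ R).hom.appTop z = y :=
    ⟨(AffineSpace.SpecIso κ R).inv.appTop y, by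
      rw [← CommRingCat.comp_apply, ← Scheme.Hom.comp_appTop, Iso.hom_inv_id,
        Scheme.Hom.id_appTop, CommRingCat.id_apply]⟩
  rw [AffineSpace.SpecIso_hom_appTop, CommRingCat.comp_apply]
  generalize (Scheme.ΓSpecIso (CommRingCat.of (MvPolynomial κ R))).hom z = p
  change MvPolynomial.eval₂Hom _ _ (p : MvPolynomial κ R) ∈ _
  induction p using MvPolynomial.induction_on with
  | C r =>
    rw [MvPolynomial.eval₂Hom_C]
    exact Subring.subset_closure (Or.inl ⟨r, rfl⟩)
  | add p q hp hq => rw [map_add]; exact add_mem hp hq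
  | mul_X p i hp =>
    rw [map_mul, MvPolynomial.eval₂Hom_X']
    exact mul_mem hp (Subring.subset_closure (Or.inr ⟨i, rfl⟩))

/-- A morphism to an affine scheme is a closed immersion exactly when its source is affine and it is
surjective on global functions. Functions on affine space are generated by constants from `R` and
coordinates, so the image is generated by `baseFunctions` and the `v j`. -/
theorem isClosedImmersion_homOfVector_iff {S : Scheme.{0}} {R : CommRingCat.{0}} (f : S ⟶ Spec R)
    (U : S.Opens) {κ : Type} (v : κ → Γ(S, U)) :
    IsClosedImmersion (AffineSpace.homOfVector (U.ι ≫ f) (fun j => U.topIso.inv (v j))) ↔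
      IsAffineOpen U ∧
        Subring.closure (Set.range (baseFunctions f U) ∪ Set.range v) = ⊤ := by
  set F := AffineSpace.homOfVector (U.ι ≫ f) (fun j => U.topIso.inv (v j)) with hF
  set ψ : Γ(𝔸(κ; Spec R), ⊤) →+* Γ(S, U) := U.topIso.hom.hom.comp F.appTop.hom with hψ
  have hcoord : ∀ j, ψ (AffineSpace.coord (Spec R) j) = v j := by
    intro j
    change U.topIso.hom (F.appTop _) = _
    rw [hF, AffineSpace.homOfVector_appTop_coord]
    rw [← CommRingCat.comp_apply, Iso.inv_hom_id, CommRingCat.id_apply]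
  have hbase : ∀ r : R, ψ ((𝔸(κ; Spec R) ↘ Spec R).appTop ((Scheme.ΓSpecIso R).inv r)) =
      baseFunctions f U r := by
    intro r
    have h1 : F ≫ (𝔸(κ; Spec R) ↘ Spec R) = U.ι ≫ f := AffineSpace.homOfVector_over _ _
    have h2 := congr($(congrArg Scheme.Hom.appTop h1) ((Scheme.ΓSpecIso R).inv r))
    rw [Scheme.Hom.comp_appTop, Scheme.Hom.comp_appTop] at h2
    change U.topIso.hom (F.appTop _) = _
    refine (congrArg U.topIso.hom h2).trans ?_
    rw [CommRingCat.comp_apply, ← CommRingCat.comp_apply]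
    change _ = res _ _
    have h3 : U.ι.appTop ≫ U.topIso.hom = S.presheaf.map (homOfLE (le_top : U ≤ ⊤)).op := by
      exact (S.presheaf.map_comp _ _).symm
    exact congr($h3 _)
  have hmap : Subring.closure (Set.range (baseFunctions f U) ∪ Set.range v) = ψ.range := by
    rw [RingHom.range_eq_map, ← closure_coord_eq_top, RingHom.map_closure, Set.image_union,
      ← Set.range_comp, ← Set.range_comp]
    congr 2
    · congr 1; ext r; exact (hbase r).symm
    · congr 1; ext r; exact (hcoord r).symm
  have hsurj : Function.Surjective ψ ↔ Function.Surjective F.appTop := by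
    have hb : Function.Bijective U.topIso.hom :=
      (ConcreteCategory.isIso_iff_bijective U.topIso.hom).mp inferInstance
    exact Function.Surjective.of_comp_iff' hb F.appTop
  rw [hmap, RingHom.range_eq_top, hsurj]
  constructor
  · intro h
    obtain ⟨h1, h2⟩ := IsClosedImmersion.isAffine_surjective_of_isAffine F
    exact ⟨h1, h2⟩
  · rintro ⟨h1, h2⟩
    have : IsAffine U := h1
    exact IsClosedImmersion.of_surjective_of_isAffine F h2

/-! ### The non-vanishing locus of a section -/

theorem basicOpen_res_eq {S : Scheme.{0}} {V U : S.Opens} (h : V ≤ U) (c : Γ(S, U)) :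
    S.basicOpen (res h c) = V ⊓ S.basicOpen c :=
  S.basicOpen_res c (homOfLE h).op

theorem isUnit_of_le_basicOpen {S : Scheme.{0}} {V U : S.Opens} (h : V ≤ U) (c : Γ(S, U))
    (hc : V ≤ S.basicOpen c) : IsUnit (res h c) := by
  rw [← LineBundle.Sections.res_res hc (S.basicOpen_le c)]
  exact (RingedSpace.isUnit_res_basicOpen S.toLocallyRingedSpace.toRingedSpace c).map (res hc)

namespace LineBundle

variable {S : Scheme.{0}} {L : LineBundle S}

theorem eq_of_res_eq (L : LineBundle S) {W : S.Opens} {c d : Γ(S, W)}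
    (h : ∀ i, res (inf_le_left : W ⊓ L.U i ≤ W) c = res inf_le_left d) : c = d := by
  refine S.sheaf.eq_of_locally_eq' (fun i => W ⊓ L.U i) W (fun i => homOfLE inf_le_left) ?_ c d h
  rw [← inf_iSup_eq, L.cover, inf_top_eq]

theorem opens_le (L : LineBundle S) {V W : S.Opens} (h : ∀ i, V ⊓ L.U i ≤ W) : V ≤ W := by
  rw [← inf_top_eq V, ← L.cover, inf_iSup_eq]
  exact iSup_le h

theorem opens_ext (L : LineBundle S) {V W : S.Opens} (h : ∀ i, V ⊓ L.U i = W ⊓ L.U i) : V = W :=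
  le_antisymm (L.opens_le fun i => (h i).le.trans inf_le_left)
    (L.opens_le fun i => (h i).ge.trans inf_le_left)

namespace Sections

/-- On overlaps the coordinate of `s` in one frame is a multiple of its coordinate in another, so
where the first is invertible the second is too. -/
theorem nonvanishing_inf (s : L.Sections ⊤) (i : L.ι) :
    s.nonvanishing ⊓ L.U i = S.basicOpen (s.1 i) := by
  refine le_antisymm ?_ (le_inf (le_iSup (fun i => S.basicOpen (s.1 i)) i)
    ((S.basicOpen_le _).trans inf_le_right))
  rw [nonvanishing, iSup_inf_eq]
  refine iSup_le fun j => ?_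
  have h := congrArg S.basicOpen (s.2 j i)
  rw [S.basicOpen_mul, basicOpen_res_eq, basicOpen_res_eq] at h
  have hj : S.basicOpen (s.1 j) ≤ L.U j := (S.basicOpen_le _).trans inf_le_right
  have h' : S.basicOpen (s.1 j) ⊓ L.U i ≤ ⊤ ⊓ (L.U j ⊓ L.U i) ⊓ S.basicOpen (s.1 j) :=
    le_inf (le_inf le_top (le_inf (inf_le_left.trans hj) inf_le_right)) inf_le_left
  exact (h'.trans h.le).trans (inf_le_right.trans (by rw [basicOpen_res_eq]; exact inf_le_right))

theorem isUnit_restrict (s : L.Sections ⊤) {W : S.Opens} (h : W ≤ s.nonvanishing) (i : L.ι) :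
    IsUnit ((s.restrict (le_top : W ≤ ⊤)).1 i) :=
  isUnit_of_le_basicOpen _ _ ((inf_le_inf_right _ h).trans (s.nonvanishing_inf i).le)

/-- Where `s` does not vanish it is a frame, so quotients by `s` are unique. -/
theorem smul_restrict_injective (s : L.Sections ⊤) {W : S.Opens} (h : W ≤ s.nonvanishing)
    {c d : Γ(S, W)}
    (hcd : c • s.restrict (le_top : W ≤ ⊤) = d • s.restrict (le_top : W ≤ ⊤)) : c = d := by
  refine L.eq_of_res_eq fun i => (s.isUnit_restrict h i).mul_right_cancel ?_
  exact congrArg (fun t : L.Sections W => t.1 i) hcd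

theorem restrict_restrict {W V V' : S.Opens} (s : L.Sections W) (h : V ≤ W) (h' : V' ≤ V) :
    (s.restrict h).restrict h' = s.restrict (h'.trans h) := by
  ext i
  exact res_res _ _ _

theorem restrict_val {W V : S.Opens} (s : L.Sections W) (h : V ≤ W) (i : L.ι) :
    (s.restrict h).1 i = res (inf_le_inf_right _ h) (s.1 i) := rfl

theorem restrict_smul {W V : S.Opens} (c : Γ(S, W)) (s : L.Sections W) (h : V ≤ W) :
    (c • s).restrict h = res h c • s.restrict h := by
  ext i
  rw [restrict_val, smul_val, smul_val, restrict_val, map_mul, res_res, res_res]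

/-- Here `c` is the quotient `t / s`; in every frame it differs from the coordinate of `t` by a
unit. -/
theorem basicOpen_eq_of_restrict_eq_smul {s t : L.Sections ⊤} {c : Γ(S, s.nonvanishing)}
    (h : t.restrict (le_top : s.nonvanishing ≤ ⊤) = c • s.restrict le_top) :
    S.basicOpen c = s.nonvanishing ⊓ t.nonvanishing := by
  refine L.opens_ext fun i => ?_
  have h1 := congrArg (fun r : L.Sections s.nonvanishing => S.basicOpen (r.1 i)) h
  simp only [smul_val, S.basicOpen_mul,
    S.basicOpen_of_isUnit (s.isUnit_restrict le_rfl i)] at h1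
  rw [basicOpen_res_eq] at h1
  change S.basicOpen (res _ (t.1 i)) = _ at h1
  rw [basicOpen_res_eq, ← nonvanishing_inf] at h1
  have hc : S.basicOpen c ≤ s.nonvanishing := S.basicOpen_le c
  refine le_antisymm ?_ ?_
  · refine le_inf (le_inf (inf_le_left.trans hc) ?_) inf_le_right
    have : S.basicOpen c ⊓ L.U i ≤
        s.nonvanishing ⊓ L.U i ⊓ S.basicOpen c ⊓ (s.nonvanishing ⊓ L.U i) :=
      le_inf (le_inf (inf_le_inf_right _ hc) inf_le_left) (inf_le_inf_right _ hc)
    exact (this.trans h1.ge).trans (inf_le_right.trans inf_le_left)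
  · refine le_inf ?_ inf_le_right
    have : s.nonvanishing ⊓ t.nonvanishing ⊓ L.U i ≤
        s.nonvanishing ⊓ L.U i ⊓ (t.nonvanishing ⊓ L.U i) :=
      le_inf (inf_le_inf_right _ inf_le_left) (inf_le_inf_right _ inf_le_right)
    exact (this.trans h1.le).trans (inf_le_left.trans inf_le_right)

/-- The product of `m` sections of `L`, as a section of `L^{⊗ m}`. -/
def prod {m : ℕ} {W : S.Opens} (s : Fin m → L.Sections W) : (L.pow m).Sections W :=
  ⟨fun i => ∏ t, (s t).1 i, fun i j => by
    have hg : ((L.g i j ^ (m : ℤ) : Γ(S, L.U i ⊓ L.U j)ˣ) : Γ(S, L.U i ⊓ L.U j)) =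
        ∏ _t : Fin m, (L.g i j : Γ(S, L.U i ⊓ L.U j)) := by simp
    change _ = res _ ((L.g i j ^ (m : ℤ) : Γ(S, L.U i ⊓ L.U j)ˣ) : Γ(S, L.U i ⊓ L.U j)) * _
    rw [hg, map_prod, map_prod, map_prod, ← Finset.prod_mul_distrib]
    exact Finset.prod_congr rfl fun t _ => (s t).2 i j⟩

theorem prod_val {m : ℕ} {W : S.Opens} (s : Fin m → L.Sections W) (i : L.ι) :
    (prod s).1 i = ∏ t, (s t).1 i := rfl

theorem restrict_prod {m : ℕ} {W V : S.Opens} (s : Fin m → L.Sections W) (h : V ≤ W) :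
    (prod s).restrict h = prod fun t => (s t).restrict h := by
  ext i
  exact map_prod (res (inf_le_inf_right (L.U i) h)) (fun t => (s t).1 i) Finset.univ

theorem prod_smul {m : ℕ} {W : S.Opens} (c : Fin m → Γ(S, W)) (s : Fin m → L.Sections W) :
    (prod fun t => c t • s t) = (∏ t, c t) • prod s := by
  ext i
  rw [smul_val, map_prod, prod_val, prod_val]
  exact Finset.prod_mul_distrib (f := fun t => res (inf_le_left : W ⊓ L.U i ≤ W) (c t))
    (g := fun t => (s t).1 i)

theorem basicOpen_prod {U : S.Opens} {κ : Type} (A : Finset κ) (c : κ → Γ(S, U)) :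
    S.basicOpen (∏ t ∈ A, c t) = U ⊓ ⨅ t ∈ A, S.basicOpen (c t) := by
  classical
  induction A using Finset.induction_on with
  | empty => simp
  | insert a A ha ih =>
    rw [Finset.prod_insert ha, S.basicOpen_mul, ih, Finset.iInf_insert, inf_left_comm]

theorem le_nonvanishing_prod_iff {m : ℕ} (s : Fin m → L.Sections ⊤) {V : S.Opens} :
    V ≤ (prod s).nonvanishing ↔ ∀ t, V ≤ (s t).nonvanishing := by
  -- The extra factor `L.U i` on the right keeps this correct for `m = 0`, where the infimum is `⊤`.
  have key : ∀ i, (prod s).nonvanishing ⊓ L.U i = L.U i ⊓ ⨅ t, (s t).nonvanishing ⊓ L.U i := by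
    intro i
    refine (nonvanishing_inf (prod s) i).trans ?_
    refine (basicOpen_prod Finset.univ fun t => (s t).1 i).trans ?_
    simp only [nonvanishing_inf, top_inf_eq, Finset.mem_univ, iInf_pos]
  constructor
  · refine fun h t => L.opens_le fun i => ?_
    exact (((inf_le_inf_right _ h).trans (key i).le).trans inf_le_right).trans
      ((iInf_le _ t).trans inf_le_left)
  · refine fun h => L.opens_le fun i => ?_
    have : V ⊓ L.U i ≤ L.U i ⊓ ⨅ t, (s t).nonvanishing ⊓ L.U i :=
      le_inf inf_le_right (le_iInf fun t => inf_le_inf_right _ (h t))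
    exact (this.trans (key i).ge).trans inf_le_left

end Sections
end LineBundle

/-! ### Powers of very ample line bundles -/

/-- On an affine `U`, the functions on the basic open set of `c` form the localization of `Γ(S, U)`
at `c`. The equation `hV` allows `V` to be presented differently, as the non-vanishing locus of a
product. -/
theorem subring_eq_top_of_basicOpen {S : Scheme.{0}} {U V : S.Opens} (hU : IsAffineOpen U)
    (c : Γ(S, U)) (hV : V = S.basicOpen c) (hVU : V ≤ U) (P : Subring Γ(S, V))
    (h1 : ∀ x, res hVU x ∈ P) (h2 : ∃ d ∈ P, res hVU c * d = 1) : P = ⊤ := by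
  subst hV
  rw [eq_top_iff]
  rintro z -
  obtain ⟨d, hd, hcd⟩ := h2
  have := hU.isLocalization_basicOpen c
  obtain ⟨n, x, hx⟩ := IsLocalization.Away.surj c z
  have hx' : z * res hVU c ^ n = res hVU x := hx
  have : z = res hVU x * d ^ n := by
    rw [← hx', mul_assoc, ← mul_pow, hcd, one_pow, mul_one]
  rw [this]
  exact mul_mem (h1 x) (pow_mem hd n)

namespace LineBundle

variable {S : Scheme.{0}} {L : LineBundle S}

/-- This is `(t / s) * (s / t) = 1`, obtained by cancelling the frame `s`. -/
theorem res_mul_res_eq_one {s t : L.Sections ⊤} {c : Γ(S, s.nonvanishing)}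
    {d : Γ(S, t.nonvanishing)}
    (hc : t.restrict (le_top : s.nonvanishing ≤ ⊤) = c • s.restrict le_top)
    (hd : s.restrict (le_top : t.nonvanishing ≤ ⊤) = d • t.restrict le_top) {W : S.Opens}
    (hs : W ≤ s.nonvanishing) (ht : W ≤ t.nonvanishing) : res hs c * res ht d = 1 := by
  refine s.smul_restrict_injective hs ?_
  have hc' := congrArg (Sections.restrict hs) hc
  have hd' := congrArg (Sections.restrict ht) hd
  rw [Sections.restrict_smul, Sections.restrict_restrict, Sections.restrict_restrict] at hc' hd'
  rw [one_smul, mul_comm, mul_smul, ← hc', ← hd']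

/-- Veronese embedding by all products `σ α` of `m` of the sections, indexed by words `α`; repeated
coordinates are harmless, since only generation of rings matters. The chart of `σ α` is a basic open
set in the chart of the first letter of `α`. Changing one letter of `α` yields both the generators
of that chart and the factors of the inverse needed for the localization. -/
theorem IsVeryAmple.pow {R : CommRingCat.{0}} {f : S ⟶ Spec R} (h : L.IsVeryAmple f) {m : ℕ}
    (hm : 0 < m) : (L.pow m).IsVeryAmple f := by
  classical
  obtain ⟨N, s, hcover, hs⟩ := h
  choose q hq hclosed using hs
  simp only [isClosedImmersion_homOfVector_iff] at hclosed
  -- `Q i j` is `s j / s i`, with the omitted index `j = i` filled in by 1.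
  set Q : ∀ i _j : Fin (N + 1), Γ(S, (s i).nonvanishing) :=
    fun i j => if hj : j = i then 1 else q i ⟨j, hj⟩ with hQdef
  have hQ : ∀ i j, (s j).restrict (le_top : (s i).nonvanishing ≤ ⊤) =
      Q i j • (s i).restrict le_top := by
    intro i j
    by_cases hj : j = i
    · subst hj; simp [hQdef]
    · simp only [hQdef, dif_neg hj]; exact hq i ⟨j, hj⟩
  have hQself : ∀ i, Q i i = 1 := fun i => by simp [hQdef]
  have haff : ∀ i, IsAffineOpen (s i).nonvanishing := fun i => (hclosed i).1
  have hgen : ∀ i, Subring.closure (Set.range (baseFunctions f (s i).nonvanishing) ∪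
      Set.range (Q i)) = ⊤ := by
    intro i
    rw [eq_top_iff, ← (hclosed i).2]
    refine Subring.closure_mono (Set.union_subset_union_right _ ?_)
    rintro _ ⟨j, rfl⟩
    exact ⟨j.1, by simp only [hQdef, dif_neg j.2]⟩
  obtain ⟨M, hM⟩ : ∃ M, Fintype.card (Fin m → Fin (N + 1)) = M + 1 :=
    Nat.exists_eq_succ_of_ne_zero Fintype.card_ne_zero
  let e : Fin (M + 1) ≃ (Fin m → Fin (N + 1)) := (Fintype.equivFinOfCardEq hM).symm
  let σ : (Fin m → Fin (N + 1)) → (L.pow m).Sections ⊤ := fun α => Sections.prod fun t => s (α t)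
  have hle : ∀ (α : Fin m → Fin (N + 1)) t, (σ α).nonvanishing ≤ (s (α t)).nonvanishing :=
    fun α => (Sections.le_nonvanishing_prod_iff _).mp le_rfl
  refine ⟨M, fun c => σ (e c), ?_, fun c => ?_⟩
  · rw [eq_top_iff, ← hcover]
    refine iSup_le fun i => ?_
    -- The pure powers of the `s i` already have no common zero.
    refine le_trans ?_ (le_iSup (fun c => (σ (e c)).nonvanishing) (e.symm fun _ => i))
    refine (Sections.le_nonvanishing_prod_iff _).mpr fun t => ?_
    rw [Equiv.apply_symm_apply]
  set α := e c with hα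
  let P : (Fin m → Fin (N + 1)) → Γ(S, (σ α).nonvanishing) :=
    fun β => ∏ t, res (hle α t) (Q (α t) (β t))
  have hP : ∀ β, (σ β).restrict (le_top : (σ α).nonvanishing ≤ ⊤) =
      P β • (σ α).restrict le_top := by
    intro β
    simp only [σ, Sections.restrict_prod]
    rw [← Sections.prod_smul]
    congr 1
    funext t
    have := congrArg (Sections.restrict (hle α t)) (hQ (α t) (β t))
    rw [Sections.restrict_smul, Sections.restrict_restrict, Sections.restrict_restrict] at this
    exact this
  -- Changing only the letter at `t` leaves a single quotient, since the other factors are `Q i i =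
  -- 1`.
  have hPupdate : ∀ t j, P (Function.update α t j) = res (hle α t) (Q (α t) j) := by
    intro t j
    simp only [P]
    rw [Finset.prod_eq_single t]
    · rw [Function.update_self]
    · intro b _ hb
      rw [Function.update_of_ne hb, hQself, map_one]
    · simp
  refine ⟨fun d => P (e d.1), fun d => hP _, ?_⟩
  rw [isClosedImmersion_homOfVector_iff]
  let t₀ : Fin m := ⟨0, hm⟩
  have hopen : (σ α).nonvanishing = S.basicOpen (∏ t, Q (α t₀) (α t)) := by
    rw [Sections.basicOpen_prod]
    simp only [Finset.mem_univ, iInf_pos,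
      fun t => Sections.basicOpen_eq_of_restrict_eq_smul (hQ (α t₀) (α t))]
    refine le_antisymm (le_inf (hle α t₀) (le_iInf fun t => le_inf (hle α t₀) (hle α t))) ?_
    exact (Sections.le_nonvanishing_prod_iff _).mpr fun t =>
      inf_le_right.trans ((iInf_le _ t).trans inf_le_right)
  refine ⟨by rw [hopen]; exact (haff _).basicOpen _, ?_⟩
  set A := Subring.closure (Set.range (baseFunctions f (σ α).nonvanishing) ∪
    Set.range fun d : {d // d ≠ c} => P (e d.1)) with hA
  have hPmem : ∀ β, P β ∈ A := by
    intro β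
    -- The omitted coordinate is the quotient of `σ α` by itself, which is 1.
    by_cases hβ : e.symm β = c
    · have : β = α := by rw [hα, ← hβ, Equiv.apply_symm_apply]
      have h1 : P β = 1 := by simp [P, this, hQself]
      rw [h1]
      exact one_mem _
    · exact Subring.subset_closure (Or.inr ⟨⟨e.symm β, hβ⟩, by simp⟩)
  refine subring_eq_top_of_basicOpen (haff (α t₀)) _ hopen (hle α t₀) A ?_ ?_
  · intro x
    have hx : x ∈ Subring.closure (Set.range (baseFunctions f (s (α t₀)).nonvanishing) ∪
      Set.range (Q (α t₀))) := by rw [hgen]; trivial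
    refine (Subring.closure_le (t := A.comap (res (hle α t₀)))).mpr ?_ hx
    rintro _ (⟨r, rfl⟩ | ⟨j, rfl⟩)
    · change res _ _ ∈ A
      rw [res_baseFunctions]
      exact Subring.subset_closure (Or.inl ⟨r, rfl⟩)
    · change res _ _ ∈ A
      rw [← hPupdate]
      exact hPmem _
  -- The inverse of the product of the `s (α t) / s (α t₀)` is the product of the `s (α t₀) / s (α
  -- t)`.
  · refine ⟨∏ t, res (hle α t) (Q (α t) (α t₀)), prod_mem fun t _ => ?_, ?_⟩
    · rw [← hPupdate]
      exact hPmem _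
    · rw [map_prod, ← Finset.prod_mul_distrib]
      exact Finset.prod_eq_one fun t _ => res_mul_res_eq_one (hQ _ _) (hQ _ _) _ _

end LineBundle

/-! ### Powers of isomorphisms and linearizations. -/

namespace LineBundle

variable {S : Scheme.{0}}

theorem pow_g (L : LineBundle S) (m : ℕ) (i j : L.ι) : (L.pow m).g i j = L.g i j ^ m :=
  zpow_natCast _ _

theorem pow_mul_g (L : LineBundle S) (k m : ℕ) (i j : L.ι) :
    (L.pow (k * m : ℕ)).g i j = (L.pow k).g i j ^ m := by
  rw [pow_g, pow_g, pow_mul]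

theorem pullback_pow_g {S' : Scheme.{0}} (f : S' ⟶ S) (L : LineBundle S) (m : ℕ) (i j : L.ι) :
    ((L.pow m).pullback f).g i j = (L.pullback f).g i j ^ m :=
  map_zpow (Units.map (f.app (L.U i ⊓ L.U j)).hom.toMonoidHom) _ _ |>.trans (zpow_natCast _ _)

/-- Powers of an isomorphism from the pull-back of `L` to a power of `M`. -/
def Iso.pow {S' : Scheme.{0}} {f : S' ⟶ S} {L : LineBundle S} {M : LineBundle S'} {k : ℕ}
    (e : (L.pullback f).Iso (M.pow k)) (m : ℕ) :
    ((L.pow m).pullback f).Iso (M.pow (k * m : ℕ)) where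
  φ i a := e.φ i a ^ m
  source i j a := by
    have := congrArg (· ^ m) (e.source i j a)
    simp only [mul_pow, ← map_pow] at this
    rw [this, pullback_pow_g]
    exact congrArg (· * _) (map_pow (resU inf_le_left) ((L.pullback f).g i j) m).symm
  target i a b := by
    have := congrArg (· ^ m) (e.target i a b)
    simp only [mul_pow, ← map_pow] at this
    rw [this, pow_mul_g]

end LineBundle

/-- The power of a linearization. -/
def Linearization.pow {S : Scheme.{0}} [S.Over SpecC] {A : GmAction S} {L : LineBundle S}
    (l : Linearization A L) (m : ℕ) : Linearization A (L.pow m) where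
  φ u x i a hi ha := l.φ u x i a hi ha ^ m
  natural f u x i a hi ha hi' ha' := by rw [l.natural f u x i a hi ha hi' ha', map_pow]
  source u x i j a hi hj ha := by
    rw [l.source u x i j a hi hj ha, mul_pow, LineBundle.pow_g, map_pow]
  target u x i a b hi ha hb := by
    rw [l.target u x i a b hi ha hb, mul_pow, LineBundle.pow_g, map_pow]
  mul_act v u x i a b hi ha hb hb' := by rw [l.mul_act v u x i a b hi ha hb hb', mul_pow]

/-! ### Powers of test configurations, their dimensions and weights. -/

namespace TestConfiguration

variable {X : Scheme.{0}} [X.Over SpecC] {L : LineBundle X} {k : ℕ}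

/-- The test configuration of exponent `k * m` given by the `m`-th power of the line bundle. -/
@[reducible] def pow (T : TestConfiguration X L k) {m : ℕ} (hm : 0 < m) :
    TestConfiguration X L (k * m) where
  space := T.space
  π := T.π
  flat := T.flat
  proper := T.proper
  π_over := T.π_over
  action := T.action
  equivariant := T.equivariant
  bundle := T.bundle.pow m
  lin := T.lin.pow m
  veryAmple := T.veryAmple.pow hm
  incl := T.incl
  isFibre := T.isFibre
  isoFibre := T.isoFibre.pow m

/-- Both bundles use the same cover, so equal transition functions make their sections the same
families of functions. -/
theorem centralPow_pow_g (T : TestConfiguration X L k) {m : ℕ} (hm : 0 < m) (j : ℕ)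
    (i i' : T.bundle.ι) :
    ((T.pow hm).centralPow j).g i i' = (T.centralPow (m * j)).g i i' := by
  refine congrArg (Units.map (T.centralι.app (T.bundle.U i ⊓ T.bundle.U i')).hom.toMonoidHom) ?_
  change (T.bundle.g i i' ^ (m : ℤ)) ^ (j : ℤ) = T.bundle.g i i' ^ ((m * j : ℕ) : ℤ)
  rw [Nat.cast_mul, zpow_mul]

/-- The sections of the `j`-th power of the `m`-th power are the sections of the `m * j`-th
power. -/
def sectionsPow (T : TestConfiguration X L k) {m : ℕ} (hm : 0 < m) (j : ℕ) :
    ((T.pow hm).centralPow j).Sections ⊤ ≃ₗ[ℂ] (T.centralPow (m * j)).Sections ⊤ where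
  toFun s := ⟨s.1, fun i i' => by rw [← T.centralPow_pow_g hm]; exact s.2 i i'⟩
  invFun s := ⟨s.1, fun i i' => by rw [T.centralPow_pow_g hm]; exact s.2 i i'⟩
  map_add' _ _ := rfl
  map_smul' _ _ := rfl
  left_inv _ := rfl
  right_inv _ := rfl

theorem N_pow (T : TestConfiguration X L k) {m : ℕ} (hm : 0 < m) (j : ℕ) :
    (T.pow hm).N j = T.N (m * j) :=
  (T.sectionsPow hm j).finrank_eq

/-- The action on the central fibre is unchanged, and the lifts agree because `(φ ^ m) ^ j = φ ^ (m
* j)`. -/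
theorem weightSpace_pow (T : TestConfiguration X L k) {m : ℕ} (hm : 0 < m) (j : ℕ) (l : ℤ) :
    (T.pow hm).weightSpace j l =
      (T.weightSpace (m * j) l).comap (T.sectionsPow hm j).toLinearMap := by
  ext s
  constructor
  · intro hs Z u x x' hx i a hi ha hi' ha'
    have := hs u x x' hx i a hi ha hi' ha'
    change _ * (((T.lin.φ u (x ≫ T.centralι) i a hi' ha' ^ m) ^ j : Γ(Z, ⊤)ˣ) : Γ(Z, ⊤)) = _ at this
    rw [pow_mul]
    exact this
  · intro hs Z u x x' hx i a hi ha hi' ha'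
    have := hs u x x' hx i a hi ha hi' ha'
    rw [pow_mul] at this
    exact this

theorem w_pow (T : TestConfiguration X L k) {m : ℕ} (hm : 0 < m) (j : ℕ) :
    (T.pow hm).w j = T.w (m * j) := by
  unfold w
  refine finsum_congr fun l => ?_
  rw [T.weightSpace_pow hm j l, Submodule.comap_equiv_eq_map_symm]
  rw [LinearEquiv.finrank_map_eq]

/-! ### Expansions -/

/-- As `k > 0`, the polynomials agree at the infinitely many points `k * m` with `m` large. -/
theorem IsExpansion.eq {k d : ℕ} (hk : 0 < k) {f : ℕ → ℝ} {P Q : Polynomial ℝ}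
    (hP : IsExpansion k d f P) (hQ : IsExpansion k d f Q) : P = Q := by
  obtain ⟨M, hM⟩ := eventually_atTop.mp (hP.2.and hQ.2)
  refine Polynomial.eq_of_infinite_eval_eq P Q ?_
  refine Set.infinite_of_injective_forall_mem (f := fun i : ℕ => (k : ℝ) * ((M + i : ℕ) : ℝ)) ?_ ?_
  · intro i j hij
    have hk' : (k : ℝ) ≠ 0 := by positivity
    have := mul_left_cancel₀ hk' hij
    exact add_left_cancel (Nat.cast_injective this)
  · intro i
    obtain ⟨h1, h2⟩ := hM (M + i) (Nat.le_add_right _ _)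
    exact h1.symm.trans h2

theorem IsExpansion.expansion_eq {k d : ℕ} (hk : 0 < k) {f : ℕ → ℝ} {P : Polynomial ℝ}
    (hP : IsExpansion k d f P) : expansion k d f = P := by
  have h : ∃ P, IsExpansion k d f P := ⟨P, hP⟩
  rw [expansion, dif_pos h]
  exact h.choose_spec.eq hk hP

/-- Since `(k * m) * j = k * (m * j)`, the polynomial itself does not change. -/
theorem IsExpansion.comp_mul {k d : ℕ} {f : ℕ → ℝ} {P : Polynomial ℝ}
    (hP : IsExpansion k d f P) {m : ℕ} (hm : 0 < m) :
    IsExpansion (k * m) d (fun j => f (m * j)) P := by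
  refine ⟨hP.1, ?_⟩
  have : Tendsto (fun j : ℕ => m * j) atTop atTop := tendsto_id.const_mul_atTop' hm
  filter_upwards [this.eventually hP.2] with j hj
  rw [hj]
  push_cast
  ring_nf

theorem tendsto_eval_div_pow {P : Polynomial ℝ} {d : ℕ} (hP : P.natDegree ≤ d) :
    Tendsto (fun x : ℝ => P.eval x / x ^ d) atTop (nhds (P.coeff d)) := by
  have h1 : ∀ i ∈ Finset.range (d + 1), Tendsto (fun x : ℝ => P.coeff i * x ^ i / x ^ d) atTop
      (nhds (if i = d then P.coeff d else 0)) := by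
    intro i hi
    split_ifs with h
    · subst h
      refine tendsto_const_nhds.congr' ?_
      filter_upwards [eventually_gt_atTop 0] with x hx
      field_simp
    · have hlt : i < d := lt_of_le_of_ne (Nat.lt_succ_iff.mp (Finset.mem_range.mp hi)) h
      have := (tendsto_pow_div_pow_atTop_zero (𝕜 := ℝ) hlt).const_mul (P.coeff i)
      simpa [mul_div_assoc] using this
  have h2 := tendsto_finsetSum _ h1
  rw [Finset.sum_ite_eq' , if_pos (Finset.self_mem_range_succ d)] at h2
  refine h2.congr fun x => ?_
  rw [Polynomial.eval_eq_sum_range' (Nat.lt_succ_of_le hP), Finset.sum_div]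

/-- The Chow weights of the powers of a test configuration tend to zero. -/
theorem tendsto_div_sub_div {k n : ℕ} (hk : 0 < k) {N w : ℕ → ℝ} {P Q : Polynomial ℝ}
    (hN : IsExpansion k n N P) (hw : IsExpansion k (n + 1) w Q) (hP : P.coeff n ≠ 0) :
    Tendsto (fun m : ℕ => Q.coeff (n + 1) / P.coeff n - w m / ((k * m : ℕ) * N m)) atTop
      (nhds 0) := by
  have hx : Tendsto (fun m : ℕ => (k : ℝ) * m) atTop atTop :=
    tendsto_natCast_atTop_atTop.const_mul_atTop (by positivity)
  -- With `x = k * m`, the quotient of `w / x ^ (n + 1)` by `N / x ^ n` is `w / (x * N)`.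
  have h1 := ((tendsto_eval_div_pow hw.1).comp hx).div ((tendsto_eval_div_pow hN.1).comp hx) hP
  rw [← sub_self (Q.coeff (n + 1) / P.coeff n)]
  refine tendsto_const_nhds.sub (h1.congr' ?_)
  filter_upwards [hN.2, hw.2, eventually_gt_atTop 0] with m h2 h3 hm
  have hm' : (0 : ℝ) < m := by exact_mod_cast hm
  have hk' : (0 : ℝ) < k := by exact_mod_cast hk
  simp only [Function.comp_apply, Pi.div_apply]
  rw [h2, h3, pow_succ, Nat.cast_mul]
  -- If `N m = 0`, both sides are 0 by the convention for division by zero.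
  by_cases h0 : P.eval ((k : ℝ) * m) = 0
  · simp [h0]
  · field_simp

theorem IsExpansion.eventually_ne_zero {k n : ℕ} (hk : 0 < k) {N : ℕ → ℝ} {P : Polynomial ℝ}
    (hN : IsExpansion k n N P) (hP : P.coeff n ≠ 0) : ∀ᶠ m in atTop, N m ≠ 0 := by
  have hx : Tendsto (fun m : ℕ => (k : ℝ) * m) atTop atTop :=
    tendsto_natCast_atTop_atTop.const_mul_atTop (by positivity)
  filter_upwards [((tendsto_eval_div_pow hN.1).comp hx).eventually_ne hP, hN.2] with m h1 h2 h3
  rw [h2] at h3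
  simp [h3] at h1

/-! ### Invariance of the coefficients, and passage to the limit. -/

/-- Existence of the expansion is assumed because a sequence may have one along the multiples of `m`
without having one itself. -/
theorem a_pow (n : ℕ) (T : TestConfiguration X L k) (hk : 0 < k)
    (hN : ∃ P, IsExpansion k n (fun m => (T.N m : ℝ)) P) {m : ℕ} (hm : 0 < m) (i : ℕ) :
    (T.pow hm).a n i = T.a n i := by
  obtain ⟨P, hP⟩ := hN
  have hP' := hP.comp_mul hm
  simp only [← T.N_pow hm] at hP'
  rw [a, a, hP.expansion_eq hk, hP'.expansion_eq (Nat.mul_pos hk hm)]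

theorem b_pow (n : ℕ) (T : TestConfiguration X L k) (hk : 0 < k)
    (hw : ∃ Q, IsExpansion k (n + 1) (fun m => (T.w m : ℝ)) Q) {m : ℕ} (hm : 0 < m) (i : ℕ) :
    (T.pow hm).b n i = T.b n i := by
  obtain ⟨Q, hQ⟩ := hw
  have hQ' := hQ.comp_mul hm
  simp only [← T.w_pow hm] at hQ'
  rw [b, b, hQ.expansion_eq hk, hQ'.expansion_eq (Nat.mul_pos hk hm)]

/-- If the quantized Futaki invariants of infinitely many powers are non-negative, then so is the
Donaldson-Futaki invariant. -/
theorem DF_nonneg (n : ℕ) (T : TestConfiguration X L k) (hk : 0 < k)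
    (h : ∀ᶠ m in atTop, ∀ hm : 0 < m, 0 ≤ (T.pow hm).fut n) : 0 ≤ T.DF n := by
  -- Without expansions the coefficients take the default value 0, and then DF is 0; it is also 0
  -- when `a_0 = 0`, by division by zero. Otherwise the limit argument applies.
  by_cases hN : ∃ P, IsExpansion k n (fun m => (T.N m : ℝ)) P
  swap
  · have : ∀ i, T.a n i = 0 := fun i => by simp [a, expansion, dif_neg hN]
    simp [DF, this]
  by_cases hw : ∃ Q, IsExpansion k (n + 1) (fun m => (T.w m : ℝ)) Q
  swap
  · have : ∀ i, T.b n i = 0 := fun i => by simp [b, expansion, dif_neg hw]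
    simp [DF, this]
  by_cases h0 : T.a n 0 = 0
  · simp [DF, h0]
  have ha := fun {m : ℕ} (hm : 0 < m) i => T.a_pow n hk hN hm i
  have hb := fun {m : ℕ} (hm : 0 < m) i => T.b_pow n hk hw hm i
  obtain ⟨P, hP⟩ := hN
  obtain ⟨Q, hQ⟩ := hw
  have ha0 : T.a n 0 = P.coeff n := by simp [a, hP.expansion_eq hk]
  have hb0 : T.b n 0 = Q.coeff (n + 1) := by simp [b, hQ.expansion_eq hk]
  rw [ha0] at h0
  have hlim := (tendsto_div_sub_div hk hP hQ h0).const_add (T.DF n)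
  rw [add_zero] at hlim
  refine ge_of_tendsto hlim ?_
  filter_upwards [h, hP.eventually_ne_zero hk h0, eventually_gt_atTop 0] with m hfut hNm hm
  have hNm' : (0 : ℝ) < T.N m := lt_of_le_of_ne (Nat.cast_nonneg _) hNm.symm
  have hkm : (0 : ℝ) < (k * m : ℕ) := by exact_mod_cast Nat.mul_pos hk hm
  have h1 := hfut hm
  rw [fut, T.N_pow hm, mul_one] at h1
  -- Dividing by `km N_{km} > 0` leaves DF + Chow ≥ 0 for the `m`-th power.
  have h2 := nonneg_of_mul_nonneg_right h1 (mul_pos hkm hNm')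
  rw [DF, chow, T.N_pow hm, T.w_pow hm, mul_one, ha, ha, hb, hb] at h2
  rw [DF, ← ha0, ← hb0]
  exact h2

end TestConfiguration
end FStability

end

theorem mainTheorem5 {n : ℕ} (F : FStability.FanoManifold n)
    (hF : F.AsymptoticallyFSemistable) : F.KSemistable := by
  intro k hk T
  obtain ⟨k₀, -, h⟩ := hF
  refine T.DF_nonneg n hk ?_
  -- As `k ≥ 1`, the exponent `k * m` is at least `k₀` once `m` is.
  filter_upwards [Filter.eventually_ge_atTop k₀] with m hm hm0
  exact h _ (hm.trans (Nat.le_mul_of_pos_left m hk)) _
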